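/- For $t\in\mathbb{C}\setminus\{0\}$ and $\nu\in\mathbb{C}$ let $$J_\nu(t)=\left(\frac t2\right)^{\nu}\sum_{k=0}^{\infty}\frac{(-1)^k}{k!\,\Gamma(\nu+k+1)}\left(\frac t2\right)^{2k}$$ be the Bessel function of the first kind (principal branch of $(t/2)^\nu$), where $1/\Gamma$ is the entire reciprocal Gamma function, and let $$Y_\nu(t)=\frac{J_\nu(t)\cos(\nu\pi)-J_{-\nu}(t)}{\sin(\nu\pi)}\quad(\nu\notin\mathbb{Z}),\qquad Y_n(t)=\lim_{\nu\to n}Y_\nu(t)\quad(n\in\mathbb{Z})$$ be the Bessel function of the second kind. **Theorem.** Let $t\in\mathbb{C}$, $t\neq 0$. Then $\nu\mapsto J_\nu(t)$ and $\nu\mapsto Y_\nu(t)$ are differentiable in $\nu$ on all of $\mathbb{C}$, and for every integer $m\ge 0$ $$\left.\frac{\partial^2 Y_\nu(t)}{\partial\nu^2}\right|_{\nu=m}+(-1)^{m+1}\left.\frac{\partial^2 Y_\nu(t)}{\partial\nu^2}\right|_{\nu=-m}=-2\pi\left.\frac{\partial J_\nu(t)}{\partial\nu}\right|_{\nu=m}+\pi^2\,Y_m(t),$$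 and, in closed form, $$\left.\frac{\partial^2 Y_\nu(t)}{\partial\nu^2}\right|_{\nu=m}+(-1)^{m+1}\left.\frac{\partial^2 Y_\nu(t)}{\partial\nu^2}\right|_{\nu=-m}=-\pi\,m!\sum_{k=0}^{m-1}\frac{J_k(t)}{k!\,(m-k)}\left(\frac t2\right)^{k-m}.$$ -/

import Mathlib

open scoped Topology Nat

/-- The Bessel function of the first kind of complex order `ν`, on the principal branch of
`(t / 2) ^ ν`. Here `(Complex.Gamma s)⁻¹` is the entire function `1 / Γ(s)`: Mathlib sets
`Complex.Gamma s = 0` at the poles `s = 0, -1, -2, …`, so that the inverse is `0` there. -/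
noncomputable def besselJ (ν t : ℂ) : ℂ :=
  (t / 2) ^ ν *
    ∑' k : ℕ, (-1) ^ k * (t / 2) ^ (2 * k) * ((k ! : ℂ) * Complex.Gamma (ν + k + 1))⁻¹

/-- The quotient `(J_ν(t) cos(νπ) - J_{-ν}(t)) / sin(νπ)`, meaningful for non-integral `ν`. -/
noncomputable def besselYQuotient (ν t : ℂ) : ℂ :=
  (besselJ ν t * Complex.cos (ν * Real.pi) - besselJ (-ν) t) / Complex.sin (ν * Real.pi)

open Classical in
/-- The Bessel function of the second kind of complex order `ν`: the quotient
`(J_ν(t) cos(νπ) - J_{-ν}(t)) / sin(νπ)` if `ν` is not an integer, and the limit of this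
quotient as the order tends to `ν` if `ν` is an integer. -/
noncomputable def besselY (ν t : ℂ) : ℂ :=
  if ∃ n : ℤ, ν = n then Filter.limUnder (𝓝[≠] ν) (fun μ : ℂ => besselYQuotient μ t)
  else besselYQuotient ν t

/-! Since `1 / Γ` is entire, `J_ν` is entire in `ν`, and the zeros of `sin(νπ)` are removable for
`Y_ν`. Differentiating the reflection formula `besselY_neg` twice at `ν = m` gives the first
identity. L'Hôpital (`besselY_int`) gives `π Y_m = J'(m) + (-1)^m J'(-m)`, primes denoting
derivatives in the order, so the right side becomes `-π D_m` with `D_m = J'(m) - (-1)^m J'(-m)`. The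
three-term recurrence, differentiated in the order, yields an inhomogeneous recurrence for `D_m`.
The finite sum satisfies the same one (`sum_three_term_recurrence`) with the same values at `m = 0,
1`. -/

open Complex Filter

/-! ### Holomorphy of `J_ν` in the order -/

/-- On bounded sets of orders, the coefficients `1 / Γ(ν + k + 1)` are bounded uniformly in `k`. -/
lemma exists_norm_inv_Gamma_le (R : ℝ) :
    ∃ M : ℝ, ∀ ν : ℂ, ‖ν‖ ≤ R → ∀ k : ℕ, ‖(Gamma (ν + k + 1))⁻¹‖ ≤ M := by
  have hcpt : ∀ k : ℕ, ∃ M : ℝ, ∀ ν ∈ Metric.closedBall (0 : ℂ) R,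
      ‖(Gamma (ν + k + 1))⁻¹‖ ≤ M := fun k ↦
    (isCompact_closedBall (0 : ℂ) R).exists_bound_of_continuousOn
      (differentiable_one_div_Gamma.continuous.comp
        (by fun_prop : Continuous fun ν : ℂ ↦ ν + k + 1)).continuousOn
  choose M hM using hcpt
  have hM0 (ν : ℂ) (hν : ‖ν‖ ≤ R) (k : ℕ) : 0 ≤ M k :=
    (norm_nonneg _).trans (hM k ν (by simpa using hν))
  set K := ⌈R⌉₊
  refine ⟨∑ k ∈ Finset.range (K + 1), M k, fun ν hν k ↦ ?_⟩
  induction k with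
  | zero =>
    exact (hM 0 ν (by simpa using hν)).trans
      (Finset.single_le_sum (f := M) (fun i _ ↦ hM0 ν hν i) (by simp))
  | succ k ih =>
    by_cases hk : k + 1 ≤ K
    · exact (hM (k + 1) ν (by simpa using hν)).trans
        (Finset.single_le_sum (f := M) (fun i _ ↦ hM0 ν hν i)
          (Finset.mem_range.2 (by omega)))
    -- Once `k ≥ R`, `1/Γ(s) = s/Γ(s+1)` with `s = ν + k + 1` and `‖s‖ ≥ 1` makes the norms
    -- nonincreasing in `k`, so finitely many compactness bounds suffice.
    · refine le_trans ?_ ih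
      have hRk : R ≤ k := (Nat.le_ceil R).trans (by exact_mod_cast (by omega : K ≤ k))
      have h1 : 1 ≤ ‖ν + k + 1‖ := by
        have h2 : ‖((k : ℂ) + 1)‖ = k + 1 := by
          rw [← Nat.cast_succ, Complex.norm_natCast]; push_cast; rfl
        have h3 : ‖((k : ℂ) + 1)‖ - ‖-ν‖ ≤ ‖((k : ℂ) + 1) - -ν‖ := norm_sub_norm_le _ _
        rw [norm_neg, h2, sub_neg_eq_add, add_comm _ ν, ← add_assoc] at h3
        linarith
      rw [one_div_Gamma_eq_self_mul_one_div_Gamma_add_one (ν + k + 1), norm_mul]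
      push_cast
      rw [← add_assoc ν]
      exact le_mul_of_one_le_left (norm_nonneg _) h1

/-- The terms of the power series of the Bessel function of order `ν`, in terms of `z = t / 2`. -/
noncomputable def besselTerm (z ν : ℂ) (k : ℕ) : ℂ :=
  (-1) ^ k * z ^ (2 * k) * ((k ! : ℂ) * Gamma (ν + k + 1))⁻¹

lemma norm_besselTerm_le {z ν : ℂ} {M : ℝ} {k : ℕ} (h : ‖(Gamma (ν + k + 1))⁻¹‖ ≤ M) :
    ‖besselTerm z ν k‖ ≤ (‖z‖ ^ 2) ^ k / k ! * M := by
  rw [besselTerm, mul_inv, ← mul_assoc, norm_mul]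
  refine (mul_le_mul_of_nonneg_left h (norm_nonneg _)).trans_eq ?_
  simp [pow_mul, div_eq_mul_inv]

lemma summable_besselTerm (z ν : ℂ) : Summable (besselTerm z ν) := by
  obtain ⟨M, hM⟩ := exists_norm_inv_Gamma_le ‖ν‖
  exact .of_norm_bounded ((Real.summable_pow_div_factorial (‖z‖ ^ 2)).mul_right M)
    fun k ↦ norm_besselTerm_le (hM ν le_rfl k)

lemma differentiable_tsum_besselTerm (z : ℂ) :
    Differentiable ℂ fun ν ↦ ∑' k, besselTerm z ν k := by
  intro ν
  obtain ⟨M, hM⟩ := exists_norm_inv_Gamma_le (‖ν‖ + 1)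
  have h : DifferentiableOn ℂ (fun ν ↦ ∑' k, besselTerm z ν k) (Metric.ball 0 (‖ν‖ + 1)) := by
    refine differentiableOn_tsum_of_summable_norm
      ((Real.summable_pow_div_factorial (‖z‖ ^ 2)).mul_right M) (fun k ↦ ?_) Metric.isOpen_ball
      fun k w hw ↦ norm_besselTerm_le (hM w (by simpa using (mem_ball_zero_iff.1 hw).le) k)
    simp only [besselTerm, mul_inv]
    have := differentiable_one_div_Gamma.comp
        (by fun_prop : Differentiable ℂ fun ν : ℂ ↦ ν + k + 1)
    exact ((this.const_mul _).const_mul _).differentiableOn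
  exact h.differentiableAt (Metric.isOpen_ball.mem_nhds (by simp))

lemma besselJ_eq (ν t : ℂ) : besselJ ν t = (t / 2) ^ ν * ∑' k, besselTerm (t / 2) ν k := rfl

lemma differentiable_besselJ {t : ℂ} (ht : t ≠ 0) : Differentiable ℂ fun ν ↦ besselJ ν t := by
  have hz : t / 2 ≠ 0 := by simpa using ht
  simp only [besselJ_eq]
  exact (differentiable_id.const_cpow (.inl hz)).mul (differentiable_tsum_besselTerm _)

/-! ### Recurrences and integral orders -/

/-- By `1/Γ(ν+k) = (ν+k)/Γ(ν+k+1)`, valid also at the poles, the termwise difference carries a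
factor `k`. It cancels against `k!`, and shifting the index raises the order. -/
lemma tsum_besselTerm_sub_one (z ν : ℂ) :
    ∑' k, besselTerm z (ν - 1) k
      = ν * ∑' k, besselTerm z ν k - z ^ 2 * ∑' k, besselTerm z (ν + 1) k := by
  have hterm (k : ℕ) : besselTerm z (ν - 1) k - ν * besselTerm z ν k = k * besselTerm z ν k := by
    have := one_div_Gamma_eq_self_mul_one_div_Gamma_add_one (ν + k)
    simp only [besselTerm, mul_inv, show ν - 1 + k + 1 = ν + k by ring, this]
    ring
  have hsub := (summable_besselTerm z (ν - 1)).sub ((summable_besselTerm z ν).mul_left ν)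
  have hshift (k : ℕ) : ((k + 1 : ℕ) : ℂ) * besselTerm z ν (k + 1)
      = -(z ^ 2) * besselTerm z (ν + 1) k := by
    have : ((k : ℂ) + 1) ≠ 0 := by exact_mod_cast k.succ_ne_zero
    simp only [besselTerm, mul_inv, Nat.factorial_succ, Nat.cast_mul, Nat.cast_add, Nat.cast_one,
      show ν + (k + 1) + 1 = ν + 1 + k + 1 by ring]
    field_simp
    ring
  have key : ∑' k, (besselTerm z (ν - 1) k - ν * besselTerm z ν k)
      = -(z ^ 2) * ∑' k, besselTerm z (ν + 1) k := by
    rw [hsub.tsum_eq_zero_add, hterm, ← tsum_mul_left]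
    simp only [hterm, hshift, Nat.cast_zero, zero_mul, zero_add]
  rw [(summable_besselTerm z (ν - 1)).tsum_sub ((summable_besselTerm z ν).mul_left ν),
    tsum_mul_left] at key
  linear_combination key

/-- The three-term recurrence `J_{ν-1} + J_{ν+1} = (2ν / t) J_ν`. -/
lemma besselJ_sub_one_add_besselJ_add_one {t : ℂ} (ht : t ≠ 0) (ν : ℂ) :
    besselJ (ν - 1) t + besselJ (ν + 1) t = ν / (t / 2) * besselJ ν t := by
  have hz : t / 2 ≠ 0 := by simpa using ht
  rw [besselJ_eq, besselJ_eq, besselJ_eq, tsum_besselTerm_sub_one, cpow_sub _ _ hz,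
    cpow_add _ _ hz, cpow_one]
  field_simp
  ring

/-- The derivative with respect to the order of the three-term recurrence. -/
lemma deriv_besselJ_sub_one_add_deriv_besselJ_add_one {t : ℂ} (ht : t ≠ 0) (ν : ℂ) :
    deriv (fun ν ↦ besselJ ν t) (ν - 1) + deriv (fun ν ↦ besselJ ν t) (ν + 1)
      = ν / (t / 2) * deriv (fun ν ↦ besselJ ν t) ν + besselJ ν t / (t / 2) := by
  have hJ (μ : ℂ) := (differentiable_besselJ ht μ).hasDerivAt
  have h1 := ((hJ (ν - 1)).comp_sub_const ν 1).add ((hJ (ν + 1)).comp_add_const ν 1)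
  have h2 := ((hasDerivAt_id ν).div_const (t / 2)).mul (hJ ν)
  have := h1.unique (h2.congr_of_eventuallyEq
    (.of_forall fun μ ↦ besselJ_sub_one_add_besselJ_add_one ht μ))
  simp only [id] at this
  linear_combination this

/-- Both sides obey the same recurrence; at `ν = 0` its right side vanishes, which settles `n = 1`.
-/
lemma besselJ_neg_nat {t : ℂ} (ht : t ≠ 0) (n : ℕ) :
    besselJ (-n) t = (-1) ^ n * besselJ n t := by
  induction n using Nat.twoStepInduction with
  | zero => simp
  | one =>
    have := besselJ_sub_one_add_besselJ_add_one ht 0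
    simp only [zero_sub, zero_add, zero_div, zero_mul] at this
    push_cast
    linear_combination this
  | more n ih0 ih1 =>
    have h1 := besselJ_sub_one_add_besselJ_add_one ht (n + 1)
    have h2 := besselJ_sub_one_add_besselJ_add_one ht (-(n + 1))
    rw [show (-((n : ℂ) + 1) - 1) = -(n + 2) by ring,
      show (-((n : ℂ) + 1) + 1) = -n by ring] at h2
    rw [show ((n : ℂ) + 1 + 1) = n + 2 by ring, add_sub_cancel_right] at h1
    push_cast at ih0 ih1 ⊢
    rw [ih0, ih1] at h2
    rw [pow_succ] at h2 ⊢
    linear_combination h2 - (-1) ^ n * h1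

lemma cos_natCast_mul_pi (n : ℕ) : cos (n * Real.pi) = (-1) ^ n := by
  have h := congrArg Complex.ofReal (Real.cos_nat_mul_pi n)
  push_cast at h
  exact h

lemma besselJ_neg_int {t : ℂ} (ht : t ≠ 0) (n : ℤ) :
    besselJ (-n) t = cos (n * Real.pi) * besselJ n t := by
  obtain ⟨n, rfl | rfl⟩ := n.eq_nat_or_neg
  · simpa [cos_natCast_mul_pi] using besselJ_neg_nat ht n
  · simp [cos_natCast_mul_pi, besselJ_neg_nat ht n, ← mul_assoc, ← mul_pow]

/-! ### `Y_ν` at integral orders and reflection -/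

lemma hasDerivAt_sin_mul_pi (ν : ℂ) :
    HasDerivAt (fun ν : ℂ ↦ sin (ν * Real.pi)) (cos (ν * Real.pi) * Real.pi) ν := by
  simpa using ((hasDerivAt_id ν).mul_const (Real.pi : ℂ)).csin

lemma hasDerivAt_cos_mul_pi (ν : ℂ) :
    HasDerivAt (fun ν : ℂ ↦ cos (ν * Real.pi)) (-sin (ν * Real.pi) * Real.pi) ν := by
  simpa using ((hasDerivAt_id ν).mul_const (Real.pi : ℂ)).ccos

lemma sin_mul_pi_eq_zero_iff (ν : ℂ) : sin (ν * Real.pi) = 0 ↔ ∃ n : ℤ, ν = n := by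
  simp [sin_eq_zero_iff, Real.pi_ne_zero]

lemma cos_int_mul_pi_mul_self (n : ℤ) : cos (n * Real.pi) * cos (n * Real.pi) = 1 := by
  have h := sin_sq_add_cos_sq ((n : ℂ) * Real.pi)
  rw [(sin_mul_pi_eq_zero_iff n).2 ⟨n, rfl⟩] at h
  linear_combination h

/-- At an integral order the Bessel function of the second kind is differentiable, and its value
is given by L'Hôpital's rule. -/
lemma besselY_int {t : ℂ} (ht : t ≠ 0) (n : ℤ) :
    DifferentiableAt ℂ (fun ν ↦ besselY ν t) n ∧
      besselY n t * Real.pi = deriv (fun ν ↦ besselJ ν t) n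
        + cos (n * Real.pi) * deriv (fun ν ↦ besselJ ν t) (-n) := by
  have hJ (μ : ℂ) := (differentiable_besselJ ht μ).hasDerivAt
  set N : ℂ → ℂ := fun ν ↦ besselJ ν t * cos (ν * Real.pi) - besselJ (-ν) t with hN
  set S : ℂ → ℂ := fun ν ↦ sin (ν * Real.pi) with hS
  have hN' (ν : ℂ) : HasDerivAt N (deriv (fun ν ↦ besselJ ν t) ν * cos (ν * Real.pi)
      + besselJ ν t * (-sin (ν * Real.pi) * Real.pi)
      - (-1 : ℂ) • deriv (fun ν ↦ besselJ ν t) (-ν)) ν := ((hJ ν).mul (hasDerivAt_cos_mul_pi ν)).sub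
    ((hJ (-ν)).scomp ν (hasDerivAt_neg ν))
  have hNd : Differentiable ℂ N := fun ν ↦ (hN' ν).differentiableAt
  have hSd : Differentiable ℂ S := fun ν ↦ (hasDerivAt_sin_mul_pi ν).differentiableAt
  have hSn : S n = 0 := (sin_mul_pi_eq_zero_iff n).2 ⟨n, rfl⟩
  have hNn : N n = 0 := by simp only [hN, besselJ_neg_int ht]; ring
  have hcc := cos_int_mul_pi_mul_self n
  have hc0 : cos (n * Real.pi) ≠ 0 := left_ne_zero_of_mul_eq_one hcc
  have hpi : (Real.pi : ℂ) ≠ 0 := by exact_mod_cast Real.pi_ne_zero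
  have hS0 : dslope S n n ≠ 0 := by
    rw [dslope_same, (hasDerivAt_sin_mul_pi n).deriv]
    exact mul_ne_zero hc0 hpi
  have hdiff {f : ℂ → ℂ} (hf : Differentiable ℂ f) : DifferentiableAt ℂ (dslope f n) n :=
    ((Complex.differentiableOn_dslope univ_mem).2 hf.differentiableOn).differentiableAt univ_mem
  -- Numerator and denominator both vanish at `n`; dividing each by `ν - n` removes the singularity.
  set g : ℂ → ℂ := fun ν ↦ dslope N n ν / dslope S n ν with hg
  have hgd : DifferentiableAt ℂ g n := (hdiff hNd).div (hdiff hSd) hS0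
  have hquot : ∀ᶠ ν in 𝓝[≠] (n : ℂ), besselYQuotient ν t = g ν := by
    filter_upwards [self_mem_nhdsWithin] with ν hν
    have hν' : ν - n ≠ 0 := sub_ne_zero.2 hν
    rw [hg]
    simp only [dslope_of_ne _ hν, slope_def_field, hNn, hSn, sub_zero]
    rw [div_div_div_cancel_right₀ hν']
    rfl
  have hYn : besselY n t = g n := by
    rw [besselY, if_pos ⟨n, rfl⟩]
    exact ((hgd.continuousAt.tendsto.mono_left nhdsWithin_le_nhds).congr'
      (hquot.mono fun _ h ↦ h.symm)).limUnder_eq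
  have hne : ∀ᶠ ν : ℂ in 𝓝[≠] (n : ℂ), ¬ ∃ k : ℤ, ν = k := by
    have := (hdiff hSd).continuousAt.eventually_ne hS0
    filter_upwards [nhdsWithin_le_nhds this, self_mem_nhdsWithin] with ν h hν
    rw [← sin_mul_pi_eq_zero_iff]
    rw [dslope_of_ne _ hν, slope_def_field, hSn, sub_zero] at h
    exact fun h0 ↦ h (by simp [hS, h0])
  have hY : (fun ν ↦ besselY ν t) =ᶠ[𝓝 (n : ℂ)] g := by
    have : ∀ᶠ ν in 𝓝[≠] (n : ℂ), besselY ν t = g ν := by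
      filter_upwards [hquot, hne] with ν h1 h2
      rw [besselY, if_neg h2, h1]
    rw [eventually_nhdsWithin_iff] at this
    filter_upwards [this] with ν h
    by_cases hν : ν = n
    · rw [hν, hYn]
    · exact h hν
  refine ⟨hgd.congr_of_eventuallyEq hY, ?_⟩
  rw [hYn, hg]
  simp only [dslope_same]
  rw [(hasDerivAt_sin_mul_pi n).deriv, (hN' n).deriv, (sin_mul_pi_eq_zero_iff n).2 ⟨n, rfl⟩]
  field_simp
  simp only [smul_eq_mul]
  linear_combination (-deriv (fun ν ↦ besselJ ν t) (-n)) * hcc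

lemma differentiable_besselY {t : ℂ} (ht : t ≠ 0) : Differentiable ℂ fun ν ↦ besselY ν t := by
  intro ν
  by_cases hν : ∃ n : ℤ, ν = n
  · obtain ⟨n, rfl⟩ := hν
    exact (besselY_int ht n).1
  · have hJ := differentiable_besselJ ht
    rw [← sin_mul_pi_eq_zero_iff] at hν
    have hd : DifferentiableAt ℂ (fun ν ↦ besselYQuotient ν t) ν :=
      ((hJ.mul fun ν ↦ (hasDerivAt_cos_mul_pi ν).differentiableAt).sub
        (hJ.comp differentiable_neg) ν).div (hasDerivAt_sin_mul_pi ν).differentiableAt hν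
    refine hd.congr_of_eventuallyEq ?_
    filter_upwards [(hasDerivAt_sin_mul_pi ν).continuousAt.eventually_ne hν] with μ hμ
    rw [Ne, sin_mul_pi_eq_zero_iff] at hμ
    rw [besselY, if_neg hμ]

/-- The reflection formula `Y_{-ν} = sin(νπ) J_ν + cos(νπ) Y_ν`. -/
lemma besselY_neg {t : ℂ} (ht : t ≠ 0) (ν : ℂ) :
    besselY (-ν) t = sin (ν * Real.pi) * besselJ ν t + cos (ν * Real.pi) * besselY ν t := by
  by_cases hν : ∃ n : ℤ, ν = n
  · obtain ⟨n, rfl⟩ := hν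
    have hpi : (Real.pi : ℂ) ≠ 0 := by exact_mod_cast Real.pi_ne_zero
    have h1 := (besselY_int ht n).2
    have h2 := (besselY_int ht (-n)).2
    push_cast at h2
    rw [neg_mul, cos_neg, neg_neg] at h2
    rw [(sin_mul_pi_eq_zero_iff n).2 ⟨n, rfl⟩]
    -- At an integer, the formula compares the L'Hôpital values at `n` and `-n`, using `cos(nπ)² =
    -- 1`.
    refine mul_right_cancel₀ hpi ?_
    linear_combination h2 - cos (n * Real.pi) * h1
      - deriv (fun ν ↦ besselJ ν t) (-n) * cos_int_mul_pi_mul_self n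
  · have hν' : ¬ ∃ n : ℤ, -ν = n := by
      rintro ⟨n, hn⟩
      exact hν ⟨-n, by push_cast; rw [← hn, neg_neg]⟩
    rw [besselY, besselY, if_neg hν, if_neg hν', besselYQuotient, besselYQuotient]
    rw [← sin_mul_pi_eq_zero_iff] at hν
    rw [neg_mul, sin_neg, cos_neg, neg_neg]
    field_simp
    linear_combination (-besselJ ν t) * sin_sq_add_cos_sq (ν * Real.pi)

lemma iteratedDeriv_two_besselY_neg_int {t : ℂ} (ht : t ≠ 0) (n : ℤ) :
    iteratedDeriv 2 (fun ν ↦ besselY ν t) (-n)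
      = cos (n * Real.pi) * (2 * Real.pi * deriv (fun ν ↦ besselJ ν t) n
        + iteratedDeriv 2 (fun ν ↦ besselY ν t) n - Real.pi ^ 2 * besselY n t) := by
  have hJ := differentiable_besselJ ht
  have hY := differentiable_besselY ht
  have h1 (ν : ℂ) := ((hasDerivAt_sin_mul_pi ν).mul (hJ ν).hasDerivAt).add
    ((hasDerivAt_cos_mul_pi ν).mul (hY ν).hasDerivAt)
  have h2 := ((((hasDerivAt_cos_mul_pi n).mul_const (Real.pi : ℂ)).mul (hJ n).hasDerivAt).add
    ((hasDerivAt_sin_mul_pi n).mul (hJ.deriv n).hasDerivAt)).add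
    ((((hasDerivAt_sin_mul_pi n).neg.mul_const (Real.pi : ℂ)).mul (hY n).hasDerivAt).add
    ((hasDerivAt_cos_mul_pi n).mul (hY.deriv n).hasDerivAt))
  -- The sign from `ν ↦ -ν` is `(-1)^2 = 1`.
  have h := iteratedDeriv_comp_neg 2 (fun ν ↦ besselY ν t) (n : ℂ)
  simp only [besselY_neg ht] at h
  simp only [iteratedDeriv_succ, iteratedDeriv_zero] at h ⊢
  have hfun := funext fun ν ↦ (h1 ν).deriv
  have h3 : deriv (deriv fun ν ↦ sin (ν * Real.pi) * besselJ ν t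
      + cos (ν * Real.pi) * besselY ν t) n = _ := (congrArg (deriv · (n : ℂ)) hfun).trans h2.deriv
  rw [h3, (sin_mul_pi_eq_zero_iff n).2 ⟨n, rfl⟩] at h
  simp only [smul_eq_mul, Pi.neg_apply, (sin_mul_pi_eq_zero_iff n).2 ⟨n, rfl⟩] at h
  linear_combination -h

/-! ### The closed form -/

/-- A finite sum satisfying the inhomogeneous three-term recurrence, whenever its coefficient
sequence `f` satisfies the three-term recurrence of the Bessel functions. -/
lemma sum_three_term_recurrence {z : ℂ} (hz : z ≠ 0) (f : ℕ → ℂ)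
    (hf : ∀ k : ℕ, f k + f (k + 2) = (k + 1) / z * f (k + 1)) (E : ℕ → ℂ)
    (hE : ∀ m, E m = (m ! : ℂ) * ∑ k ∈ Finset.range m,
      f k / ((k ! : ℂ) * ((m : ℂ) - k)) * z ^ ((k : ℤ) - m)) (m : ℕ) :
    E (m + 2) + E m = (m + 1) / z * E (m + 1) + 2 * f (m + 1) / z := by
  set u : ℕ → ℂ := fun k ↦ z ^ ((k : ℤ) - m - 2) * f k with hu
  -- Telescoping primitive for `htel`: `e 0 = 0` and `e m = m * u (m + 1)`.
  set e : ℕ → ℂ := fun k ↦ (m ! : ℂ) * k / ((k ! : ℂ) * ((m : ℂ) + 1 - k)) * u (k + 1) with he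
  have hfac (k : ℕ) : (k ! : ℂ) ≠ 0 := by exact_mod_cast k.factorial_ne_zero
  have hsub {a k : ℕ} (h : k < a) : (a : ℂ) - k ≠ 0 :=
    sub_ne_zero.2 (by exact_mod_cast h.ne')
  have hm : E m = ∑ k ∈ Finset.range m, (m ! : ℂ) / ((k ! : ℂ) * (m - k))
      * ((k + 1) * u (k + 1) - u (k + 2)) := by
    rw [hE, Finset.mul_sum]
    refine Finset.sum_congr rfl fun k hk ↦ ?_
    have h1 : z ^ (((k + 1 : ℕ) : ℤ) - m - 2) = z ^ ((k : ℤ) - m) / z := by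
      rw [div_eq_mul_inv, ← zpow_sub_one₀ hz]; congr 1; push_cast; ring
    have h2 : z ^ (((k + 2 : ℕ) : ℤ) - m - 2) = z ^ ((k : ℤ) - m) := by
      congr 1; push_cast; ring
    simp only [hu, h1, h2]
    -- The recurrence trades `f k` for `f (k + 1)` and `f (k + 2)`, so all three sums use the same
    -- `u`.
    linear_combination (m ! : ℂ) / ((k ! : ℂ) * (m - k)) * z ^ ((k : ℤ) - m) * hf k
  have hm1 : (m + 1) / z * E (m + 1) = ∑ k ∈ Finset.range (m + 1),
      (m + 1) * ((m + 1)! : ℂ) / ((k ! : ℂ) * (m + 1 - k)) * u k := by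
    rw [hE, Finset.mul_sum, Finset.mul_sum]
    refine Finset.sum_congr rfl fun k hk ↦ ?_
    have h1 : z ^ ((k : ℤ) - m - 2) = z ^ ((k : ℤ) - (m + 1 : ℕ)) / z := by
      rw [div_eq_mul_inv, ← zpow_sub_one₀ hz]; congr 1; push_cast; ring
    simp only [hu, h1]
    push_cast
    ring
  have hm2 : E (m + 2) = ∑ k ∈ Finset.range (m + 2),
      ((m + 2)! : ℂ) / ((k ! : ℂ) * (m + 2 - k)) * u k := by
    rw [hE, Finset.mul_sum]
    refine Finset.sum_congr rfl fun k hk ↦ ?_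
    have h1 : z ^ ((k : ℤ) - m - 2) = z ^ ((k : ℤ) - (m + 2 : ℕ)) := by
      congr 1; push_cast; ring
    simp only [hu, h1]
    push_cast
    ring
  have htop : 2 * f (m + 1) / z = 2 * u (m + 1) := by
    have : ((m + 1 : ℕ) : ℤ) - m - 2 = -1 := by push_cast; ring
    simp only [hu, this, zpow_neg_one]
    ring
  have hdiff : ∑ k ∈ Finset.range (m + 1), ((m + 2)! : ℂ) / ((k ! : ℂ) * (m + 2 - k)) * u k
      - ∑ k ∈ Finset.range (m + 1), (m + 1) * ((m + 1)! : ℂ) / ((k ! : ℂ) * (m + 1 - k)) * u k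
      = -∑ k ∈ Finset.range m, ((m + 1)! : ℂ) / ((k ! : ℂ) * (m - k) * (m + 1 - k))
        * u (k + 1) := by
    rw [← Finset.sum_sub_distrib, Finset.sum_range_succ', ← Finset.sum_neg_distrib]
    have h0 : ((m + 2)! : ℂ) / (((0)! : ℂ) * (m + 2 - (0 : ℕ))) * u 0
        - (m + 1) * ((m + 1)! : ℂ) / (((0)! : ℂ) * (m + 1 - (0 : ℕ))) * u 0 = 0 := by
      have h1 : (m : ℂ) + 1 ≠ 0 := by exact_mod_cast m.succ_ne_zero
      have h2 : (m : ℂ) + 2 ≠ 0 := by exact_mod_cast (m + 1).succ_ne_zero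
      simp only [Nat.factorial_succ (m + 1), Nat.cast_zero, sub_zero, Nat.factorial_zero,
        Nat.cast_one, one_mul, Nat.cast_mul, Nat.cast_add]
      field_simp
      ring
    rw [h0, add_zero]
    refine Finset.sum_congr rfl fun k hk ↦ ?_
    have hkm := Finset.mem_range.1 hk
    have h1 : (m : ℂ) - k ≠ 0 := hsub hkm
    have h2 : (m : ℂ) + 1 - k ≠ 0 := by exact_mod_cast hsub (hkm.trans m.lt_succ_self)
    have h3 : (k : ℂ) + 1 ≠ 0 := by exact_mod_cast k.succ_ne_zero
    have h4 := hfac k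
    push_cast [Nat.factorial_succ k, Nat.factorial_succ (m + 1)]
    rw [show (m : ℂ) + 2 - (k + 1) = m + 1 - k by ring,
      show (m : ℂ) + 1 - (k + 1) = m - k by ring]
    field_simp
    ring
  have htel : ∑ k ∈ Finset.range m, (m ! : ℂ) / ((k ! : ℂ) * (m - k))
        * ((k + 1) * u (k + 1) - u (k + 2))
      - ∑ k ∈ Finset.range m, ((m + 1)! : ℂ) / ((k ! : ℂ) * (m - k) * (m + 1 - k)) * u (k + 1)
      = -(m * u (m + 1)) := by
    have : -(m * u (m + 1)) = e 0 - e m := by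
      have := hfac m
      simp only [he, Nat.cast_zero, mul_zero, zero_div, zero_mul, add_sub_cancel_left]
      field_simp
      ring
    rw [this, ← Finset.sum_range_sub', ← Finset.sum_sub_distrib]
    refine Finset.sum_congr rfl fun k hk ↦ ?_
    have hkm := Finset.mem_range.1 hk
    have h1 : (m : ℂ) - k ≠ 0 := hsub hkm
    have h2 : (m : ℂ) + 1 - k ≠ 0 := by exact_mod_cast hsub (hkm.trans m.lt_succ_self)
    have h3 : (k : ℂ) + 1 ≠ 0 := by exact_mod_cast k.succ_ne_zero
    have h4 := hfac k
    simp only [he]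
    push_cast [Nat.factorial_succ k, Nat.factorial_succ m]
    rw [show (m : ℂ) + 1 - (k + 1) = m - k by ring]
    field_simp
    ring
  have hlast : ((m + 2)! : ℂ) / (((m + 1)! : ℂ) * (m + 2 - (m + 1 : ℕ))) = m + 2 := by
    have := hfac (m + 1)
    rw [Nat.factorial_succ (m + 1)]
    push_cast
    rw [show (m : ℂ) + 2 - (m + 1) = 1 by ring]
    field_simp
    ring
  -- The top term `(m + 2) * u (m + 1)` less the telescoped `m * u (m + 1)` leaves the
  -- inhomogeneity.
  rw [hm2, hm, hm1, htop, Finset.sum_range_succ, hlast]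
  linear_combination hdiff + htel

/-- The derivatives of the Bessel function with respect to the order at `m` and `-m`. -/
lemma deriv_besselJ_nat_sub_deriv_besselJ_neg_nat {t : ℂ} (ht : t ≠ 0) (m : ℕ) :
    deriv (fun ν ↦ besselJ ν t) m - (-1) ^ m * deriv (fun ν ↦ besselJ ν t) (-m)
      = (m ! : ℂ) * ∑ k ∈ Finset.range m,
        besselJ k t / ((k ! : ℂ) * ((m : ℂ) - k)) * (t / 2) ^ ((k : ℤ) - m) := by
  have hz : t / 2 ≠ 0 := by simpa using ht
  have hrec := sum_three_term_recurrence hz (fun k ↦ besselJ k t)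
    (fun k ↦ by
      have := besselJ_sub_one_add_besselJ_add_one ht (k + 1)
      rw [add_sub_cancel_right, add_assoc, one_add_one_eq_two] at this
      exact_mod_cast this) _ (fun _ ↦ rfl)
  induction m using Nat.twoStepInduction with
  | zero => simp
  | one =>
    have := deriv_besselJ_sub_one_add_deriv_besselJ_add_one ht 0
    simp only [zero_sub, zero_add, zero_div, zero_mul] at this
    simp [div_eq_mul_inv] at this ⊢
    linear_combination this
  | more m ih0 ih1 =>
    have h1 := deriv_besselJ_sub_one_add_deriv_besselJ_add_one ht (m + 1)
    have h2 := deriv_besselJ_sub_one_add_deriv_besselJ_add_one ht (-(m + 1))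
    have h3 := besselJ_neg_nat ht (m + 1)
    have h := hrec m
    rw [← ih0, ← ih1] at h
    rw [show (-((m : ℂ) + 1) - 1) = -(m + 2) by ring,
      show (-((m : ℂ) + 1) + 1) = -m by ring] at h2
    rw [show ((m : ℂ) + 1 + 1) = m + 2 by ring, add_sub_cancel_right] at h1
    push_cast at h h3 ⊢
    rw [h3] at h2
    have hs : ((-1 : ℂ) ^ m) * (-1) ^ m = 1 := by rw [← mul_pow]; simp
    simp only [pow_succ] at h h2 ⊢
    -- The signs make the inhomogeneous terms at orders `m + 1` and `-(m + 1)` add up, whence the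
    -- factor 2 in `h`.
    linear_combination h1 - (-1) ^ m * h2 - h + besselJ (m + 1) t / (t / 2) * hs

theorem mainTheorem4 (m : ℕ) (t : ℂ) (ht : t ≠ 0) :
    Differentiable ℂ (fun ν : ℂ => besselJ ν t) ∧
    Differentiable ℂ (fun ν : ℂ => besselY ν t) ∧
    iteratedDeriv 2 (fun ν : ℂ => besselY ν t) (m : ℂ)
        + (-1 : ℂ) ^ (m + 1) * iteratedDeriv 2 (fun ν : ℂ => besselY ν t) (-(m : ℂ))
      = -2 * (Real.pi : ℂ) * deriv (fun ν : ℂ => besselJ ν t) (m : ℂ)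
        + (Real.pi : ℂ) ^ 2 * besselY (m : ℂ) t ∧
    iteratedDeriv 2 (fun ν : ℂ => besselY ν t) (m : ℂ)
        + (-1 : ℂ) ^ (m + 1) * iteratedDeriv 2 (fun ν : ℂ => besselY ν t) (-(m : ℂ))
      = -(Real.pi : ℂ) * (m ! : ℂ) *
        ∑ k ∈ Finset.range m,
          besselJ (k : ℂ) t / ((k ! : ℂ) * ((m : ℂ) - (k : ℂ))) * (t / 2) ^ ((k : ℤ) - (m : ℤ)) := by
  have hs : ((-1 : ℂ) ^ m) * (-1) ^ m = 1 := by rw [← mul_pow]; simp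
  have h1 := iteratedDeriv_two_besselY_neg_int ht m
  have h2 := (besselY_int ht m).2
  have h3 := deriv_besselJ_nat_sub_deriv_besselJ_neg_nat ht m
  rw [Int.cast_natCast, cos_natCast_mul_pi] at h1 h2
  have key : iteratedDeriv 2 (fun ν : ℂ => besselY ν t) (m : ℂ)
        + (-1 : ℂ) ^ (m + 1) * iteratedDeriv 2 (fun ν : ℂ => besselY ν t) (-(m : ℂ))
      = -2 * (Real.pi : ℂ) * deriv (fun ν : ℂ => besselJ ν t) (m : ℂ)
        + (Real.pi : ℂ) ^ 2 * besselY (m : ℂ) t := by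
    rw [h1, pow_succ]
    linear_combination -(2 * Real.pi * deriv (fun ν ↦ besselJ ν t) m
        + iteratedDeriv 2 (fun ν ↦ besselY ν t) m - Real.pi ^ 2 * besselY m t) * hs
  refine ⟨differentiable_besselJ ht, differentiable_besselY ht, key, ?_⟩
  rw [key, mul_assoc (-(Real.pi : ℂ)), ← h3]
  linear_combination Real.pi * h2
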